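/- Let $\mathcal N$ be a real nuclear Fréchet space, let $\mathcal N'_{\mathbb C}$ be its complexified strong dual (the complex classical fields), and let $\Delta$ be a continuous, symmetric, positive definite real bilinear form on $\mathcal N$, extended sesquilinearly to $\mathcal N_{\mathbb C}$; write $\bar\rho\Delta\alpha$ for the extension, conjugate linear in $\rho$. Let $\mu$ be the Gaussian Borel probability measure on $\mathcal N'_{\mathbb C}$ with $$\int \exp\big(i(\langle\phi,\bar\rho\rangle+\overline{\langle\phi,\bar\rho\rangle})\big)\,d\mu(\phi)=e^{-\bar\rho\Delta\rho}\qquad(\rho\in\mathcal N_{\mathbb C}).$$ Let $\mathscr P$ be the complex vector space of holomorphic Hida test functions, i.e. of the functions $\Psi:\mathcal N'_{\mathbb C}\to\mathbb C$ that are holomorphic on complex lines and satisfy, for every continuous seminorm $p$ on $\mathcal N$ and every $\varepsilon>0$, a bound $|\Psi(\phi)|\le C e^{\varepsilon|\phi|_{p,*}^2}$, where $|\cdot|_{p,*}$ is the dual norm of $p$. Then $\mathscr P\subset L^2(\mu)$. Let $L^2_{Hol}(\mu)$ be the closure of $\mathscr P$ in $L^2(\mu)$, with scalar product $\langle\cdot,\cdot\rangle$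 conjugate linear in the first argument. The linear manifold $\mathscr P$ is Kähler with Hermitian tensor $h(u,v)=\langle u,v\rangle$. For $F:\mathscr P\to\mathbb C$, let $\partial F(v)=\frac12(dF(v)-i\,dF(iv))$ and $\bar\partial F(v)=\frac12(dF(v)+i\,dF(iv))$ be its Wirtinger derivatives, formed from the Gateaux derivative. The Kähler Poisson bracket is $$\{F,G\}_{\mathscr P}=-i\big(K(\partial F,\bar\partial G)-K(\partial G,\bar\partial F)\big),\qquad K(\langle a,\cdot\rangle,\langle\cdot,b\rangle)=\langle a,b\rangle ,\quad a,b\in L^2_{Hol}(\mu),$$ where $K$ is the inverse of $h$. For a bounded operator $\hat G$ on $L^2_{Hol}(\mu)$ let $f_{\hat G}(\bar\Psi,\Psi)=\langle\Psi,\hat G\Psi\rangle$ for $\Psi\in\mathscr P$. Define the product of two such functions by $f_{\hat G}\ast_m f_{\hat H}=f_{\hat G\hat H}$, and the Jordan product by $f\circ g=\frac12(f\ast_m g+g\ast_m f)$. Then the product $\ast_m$ is well defined (that is, $f_{\hat G}$ determines $\hat G$), quadratic functions are in the domain of the Poisson bracket, and for all bounded operators $\hat G,\hat H,\hat A,\hat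 B$: 1. $\{f_{\hat G},f_{\hat H}\}_{\mathscr P}=-i(f_{\hat G}\ast_m f_{\hat H}-f_{\hat H}\ast_m f_{\hat G})=f_{-i[\hat G,\hat H]}$. 2. $f_{\hat A}\circ f_{\hat B}=f_{(\hat A\hat B+\hat B\hat A)/2}$ and $f_{\hat A}\ast_m f_{\hat B}=f_{\hat A}\circ f_{\hat B}+\frac i2\{f_{\hat A},f_{\hat B}\}_{\mathscr P}$. Moreover, on Weyl quantizable functions $\ast_m$ is the Moyal product. Here the trigonometric exponential $\mathcal E_\chi(\phi)=\exp\big(i\langle\phi,\bar\chi\rangle+i\overline{\langle\phi,\bar\chi\rangle}\big)$, $\chi\in\mathcal N_{\mathbb C}$, is quantized by $\mathcal Q(\mathcal E_\chi)\Psi(\sigma)=e^{i\langle\sigma,\bar\chi\rangle-\bar\chi\Delta\chi/2}\,\Psi(\sigma+i\Delta\chi)$, and $\star_m$ is the bilinear product with $\mathcal E_\rho\star_m\mathcal E_\alpha=e^{(\bar\rho\Delta\alpha-\bar\alpha\Delta\rho)/2}\,\mathcal E_{\rho+\alpha}$. If $F_n,F'_n$ are trigonometric polynomials whose quantizations are bounded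 operators that converge in operator norm to $\hat G$ and $\hat H$, then the $\mathcal Q(F_n\star_m F'_n)$ converge in operator norm to an operator $\hat L$ with $f_{\hat G}\ast_m f_{\hat H}=f_{\hat L}$. -/

import Mathlib

open MeasureTheory Filter Topology Complex
open scoped InnerProductSpace

noncomputable section

/-! ### Classical fields: a nuclear Fréchet space of test functions and its complexified dual -/

/-- Grothendieck's definition of nuclearity of a real locally convex space `N`: for every continuous
seminorm `p` there is a continuous seminorm `q` such that the canonical map from `N` with `q` to the
local Banach space of `p` is nuclear, i.e. `x = ∑ c n • f n x • y n` in the seminorm `p`, with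
`∑ |c n| < ∞`, the `f n` bounded by `q` and the `y n` in the unit ball of `p`. -/
def IsNuclearTVS (N : Type*) [AddCommGroup N] [Module ℝ N] [TopologicalSpace N] : Prop :=
  ∀ p : Seminorm ℝ N, Continuous p → ∃ q : Seminorm ℝ N, Continuous q ∧
    ∃ (c : ℕ → ℝ) (f : ℕ → N →L[ℝ] ℝ) (y : ℕ → N),
      Summable (fun n => |c n|) ∧ (∀ n x, |f n x| ≤ q x) ∧ (∀ n, p (y n) ≤ 1) ∧
      ∀ x, Tendsto (fun k : ℕ => p (x - ∑ n ∈ Finset.range k, (c n * f n x) • y n)) atTop (𝓝 0)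

/-- A topological vector space is a nuclear Fréchet space: locally convex, Hausdorff, metrizable,
complete and nuclear. -/
class IsNuclearFrechet (N : Type*) [AddCommGroup N] [Module ℝ N] [UniformSpace N]
    [IsUniformAddGroup N] [ContinuousSMul ℝ N] : Prop where
  locallyConvex : LocallyConvexSpace ℝ N
  t2 : T2Space N
  firstCountable : FirstCountableTopology N
  complete : CompleteSpace N
  nuclear : IsNuclearTVS N

section Fields

variable (N : Type*) [AddCommGroup N] [Module ℝ N] [UniformSpace N]

/-- The complexified strong dual `N'_ℂ = N' ⊗ ℂ`: complex valued continuous real-linear functionals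
on the real test functions. Its elements `φ` are the complex classical fields. -/
abbrev ComplexField : Type _ := N →L[ℝ] ℂ

end Fields

/-- The real test functions `N` paired twice: `(a, b)` stands for the complex test function
`χ = a + i b` in `N_ℂ`. -/
abbrev ComplexTest (N : Type*) : Type _ := N × N

section Classical

variable {N : Type*} [AddCommGroup N] [Module ℝ N] [UniformSpace N]

/-- The pairing `χ̄ₓ φˣ`, for `χ = a + i b`. -/
def conjPair (χ : ComplexTest N) (φ : ComplexField N) : ℂ := φ χ.1 - I * φ χ.2

variable (N) in
/-- The real bilinear form `Δˣʸ` on test functions given by the classical Kähler structure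
(the inverse of the Hermitian form on fields, in holomorphic coordinates): it is symmetric,
positive definite and continuous. -/
structure CovarianceForm where
  toForm : N →ₗ[ℝ] N →ₗ[ℝ] ℝ
  symm : ∀ x y, toForm x y = toForm y x
  pos : ∀ x, x ≠ 0 → 0 < toForm x x
  cont : Continuous fun p : N × N => toForm p.1 p.2

namespace CovarianceForm

/-- The sesquilinear extension `ρ̄ₓ Δˣʸ αᵧ`. -/
def sesq (Δ : CovarianceForm N) (ρ α : ComplexTest N) : ℂ :=
  (Δ.toForm ρ.1 α.1 + Δ.toForm ρ.2 α.2 : ℝ) + I * (Δ.toForm ρ.1 α.2 - Δ.toForm ρ.2 α.1 : ℝ)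

/-- The field `Δˣʸ χᵧ`, for `χ = a + i b`. -/
def lower (Δ : CovarianceForm N) (χ : ComplexTest N) : ComplexField N where
  toFun x := (Δ.toForm x χ.1 : ℂ) + I * (Δ.toForm x χ.2 : ℂ)
  map_add' x y := by simp; ring
  map_smul' r x := by simp; ring
  cont := by
    have h : ∀ c : N, Continuous fun x : N => (Δ.toForm x c : ℂ) := fun c =>
      Complex.continuous_ofReal.comp
        (Δ.cont.comp (Continuous.prodMk continuous_id continuous_const))
    exact (h _).add (continuous_const.mul (h _))

end CovarianceForm

variable [IsUniformAddGroup N] [ContinuousSMul ℝ N]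

/-- The fields carry the Borel σ-algebra of the strong dual topology. -/
instance instMeasurableSpaceComplexField : MeasurableSpace (ComplexField N) :=
  borel (ComplexField N)

/-- `μ` is the Gaussian probability measure on the fields with characteristic functional
`∫ exp (i (ρ̄ₓ φˣ + ρₓ φ̄ˣ)) dμ(φ) = exp (- ρ̄ₓ Δˣʸ ρᵧ)`. -/
structure IsHolomorphicGaussian (Δ : CovarianceForm N) (μ : Measure (ComplexField N)) : Prop where
  isProbability : IsProbabilityMeasure μ
  charFun : ∀ ρ : ComplexTest N,
    ∫ φ, Complex.exp (I * (conjPair ρ φ + starRingEnd ℂ (conjPair ρ φ))) ∂μ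
      = Complex.exp (-(Δ.sesq ρ ρ))

/-! ### Hida test functions: the model space of the manifold of pure states -/

variable (N) in
/-- The (holomorphic) Hida test functions on the fields: functions that are holomorphic along all
complex lines and of order two and minimal type on the dual of every continuous seminorm, i.e. for
all `p` and all `ε > 0` they are bounded by `C exp (ε |φ|²)`, where `|φ|` is the norm dual to `p`
(`r` below is any bound for it). Equivalently, the Taylor kernels satisfy
`∑ n! 2 ^ (n q) |ψ⁽ⁿ⁾|ₚ² < ∞` for all `p` and `q`. The vector space is the manifold of
pure states, and it is identified with each of its tangent spaces. -/
def HidaTest : Submodule ℂ (ComplexField N → ℂ) where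
  carrier := {F | (∀ φ h : ComplexField N, Differentiable ℂ fun z : ℂ => F (φ + z • h)) ∧
    ∀ p : Seminorm ℝ N, Continuous p → ∀ ε : ℝ, 0 < ε → ∃ C : ℝ, ∀ (φ : ComplexField N) (r : ℝ),
      0 ≤ r → (∀ ξ, ‖φ ξ‖ ≤ r * p ξ) → ‖F φ‖ ≤ C * Real.exp (ε * r ^ 2)}
  zero_mem' := by
    refine ⟨fun _ _ => by simp, fun p _ ε _ => ⟨0, fun φ r _ _ => by simp⟩⟩
  add_mem' := by
    rintro F G ⟨hF, hF'⟩ ⟨hG, hG'⟩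
    refine ⟨fun φ h => (hF φ h).add (hG φ h), fun p hp ε hε => ?_⟩
    obtain ⟨C, hC⟩ := hF' p hp ε hε
    obtain ⟨D, hD⟩ := hG' p hp ε hε
    refine ⟨C + D, fun φ r hr hφ => ?_⟩
    rw [add_mul]
    exact (norm_add_le _ _).trans (add_le_add (hC φ r hr hφ) (hD φ r hr hφ))
  smul_mem' := by
    rintro c F ⟨hF, hF'⟩
    refine ⟨fun φ h => (hF φ h).const_smul c, fun p hp ε hε => ?_⟩
    obtain ⟨C, hC⟩ := hF' p hp ε hε
    refine ⟨‖c‖ * C, fun φ r hr hφ => ?_⟩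
    rw [Pi.smul_apply, norm_smul, mul_assoc]
    exact mul_le_mul_of_nonneg_left (hC φ r hr hφ) (norm_nonneg c)

/-! ### The Hilbert space of holomorphic quantization -/

open Classical in
/-- The class of a function in `L²(μ)` (and `0` if the function is not square integrable). -/
def classL2 (μ : Measure (ComplexField N)) (F : ComplexField N → ℂ) : Lp ℂ 2 μ :=
  if h : MemLp F 2 μ then h.toLp F else 0

/-- The Hilbert space `L²_Hol(N'_ℂ, μ)`: the closure in `L²(μ)` of the holomorphic Hida test
functions. -/
def L2Hol (μ : Measure (ComplexField N)) : Submodule ℂ (Lp ℂ 2 μ) :=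
  (Submodule.span ℂ (Set.range fun Ψ : HidaTest N => classL2 μ Ψ)).topologicalClosure

instance instCompleteSpaceL2Hol (μ : Measure (ComplexField N)) : CompleteSpace (L2Hol μ) :=
  Submodule.topologicalClosure.completeSpace _

/-- The inclusion of the manifold of pure states in the Hilbert space. -/
def incl (μ : Measure (ComplexField N)) (Ψ : HidaTest N) : L2Hol μ :=
  ⟨classL2 μ Ψ, Submodule.le_topologicalClosure _ (Submodule.subset_span ⟨Ψ, rfl⟩)⟩

variable {μ : Measure (ComplexField N)}

/-! ### Quadratic functions and the Kähler Poisson bracket -/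

/-- The quadratic function `f_G (Ψ̄, Ψ) = ⟨Ψ, G Ψ⟩ = ∫ conj (Ψ φ) (G Ψ) φ dμ(φ)`. -/
def quadFun (G : L2Hol μ →L[ℂ] L2Hol μ) (Ψ : HidaTest N) : ℂ :=
  ∫ φ, starRingEnd ℂ ((Ψ : ComplexField N → ℂ) φ) *
    ((G (incl μ Ψ) : Lp ℂ 2 μ) : ComplexField N → ℂ) φ ∂μ

/-- The Gateaux derivative of `F` at `Ψ` in the real direction `v`. -/
def gateaux (F : HidaTest N → ℂ) (Ψ v : HidaTest N) : ℂ :=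
  deriv (fun t : ℝ => F (Ψ + (t : ℂ) • v)) 0

/-- The Wirtinger derivative `v ↦ v^φ ∂F/∂Ψ^φ`. -/
def wirtinger (F : HidaTest N → ℂ) (Ψ v : HidaTest N) : ℂ :=
  (gateaux F Ψ v - I * gateaux F Ψ (I • v)) / 2

/-- The conjugate Wirtinger derivative `v ↦ v̄^φ ∂F/∂Ψ̄^φ`. -/
def wirtingerBar (F : HidaTest N → ℂ) (Ψ v : HidaTest N) : ℂ :=
  (gateaux F Ψ v + I * gateaux F Ψ (I • v)) / 2

/-- The vector `a` represents the holomorphic covector `α` for the Hermitian tensor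
`h(u, v) = ⟨u, v⟩` of the Kähler manifold: `α v = ⟨a, v⟩` for all tangent vectors `v`. -/
def Represents (α : HidaTest N → ℂ) (a : L2Hol μ) : Prop := ∀ v, α v = ⟪a, incl μ v⟫_ℂ

/-- The vector `b` represents the antiholomorphic covector `β`: `β v = ⟨v, b⟩`. -/
def RepresentsBar (β : HidaTest N → ℂ) (b : L2Hol μ) : Prop := ∀ v, β v = ⟪incl μ v, b⟫_ℂ

variable (μ)

open Classical in
/-- The inverse `K` of the Hermitian tensor, on a holomorphic covector `α = ⟨a, ·⟩` and an
antiholomorphic covector `β = ⟨·, b⟩`: it is `⟨a, b⟩` (and `0` on covectors not of this form). -/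
def inverseHermitian (α β : HidaTest N → ℂ) : ℂ :=
  if h : (∃ a : L2Hol μ, Represents α a) ∧ ∃ b : L2Hol μ, RepresentsBar β b then
    ⟪h.1.choose, h.2.choose⟫_ℂ else 0

/-- The Poisson bracket `-i K ∂_Ψ ∧ ∂_Ψ̄` of the Kähler manifold of pure states. -/
def poisson (F G : HidaTest N → ℂ) (Ψ : HidaTest N) : ℂ :=
  -I * (inverseHermitian μ (wirtinger F Ψ) (wirtingerBar G Ψ)
    - inverseHermitian μ (wirtinger G Ψ) (wirtingerBar F Ψ))

/-- `F` is in the domain of the Poisson bracket: it is Gateaux differentiable with real-linear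
derivatives, and its Wirtinger derivatives lie in the domain of the inverse Hermitian tensor. -/
def IsPoissonDifferentiable (F : HidaTest N → ℂ) : Prop :=
  ∀ Ψ : HidaTest N,
    (∀ v : HidaTest N, DifferentiableAt ℝ (fun t : ℝ => F (Ψ + (t : ℂ) • v)) 0) ∧
    (∃ D : HidaTest N →ₗ[ℝ] ℂ, ∀ v, gateaux F Ψ v = D v) ∧
    (∃ a : L2Hol μ, Represents (wirtinger F Ψ) a) ∧
    ∃ b : L2Hol μ, RepresentsBar (wirtingerBar F Ψ) b

open Classical in
/-- The operator of a quadratic function (and `0` if the function is not quadratic). -/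
def symbolOp (f : HidaTest N → ℂ) : L2Hol μ →L[ℂ] L2Hol μ :=
  if h : ∃ G : L2Hol μ →L[ℂ] L2Hol μ, f = quadFun G then h.choose else 0

/-- The product of quadratic functions, which corresponds to composition of operators. -/
def moyalMul (f g : HidaTest N → ℂ) : HidaTest N → ℂ :=
  quadFun (symbolOp μ f ∘L symbolOp μ g)

/-- The Jordan product of quadratic functions. -/
def jordanMul (f g : HidaTest N → ℂ) : HidaTest N → ℂ :=
  (2⁻¹ : ℂ) • (moyalMul μ f g + moyalMul μ g f)

/-! ### Weyl quantization and the Moyal product of classical functions -/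

variable (N) in
/-- The trigonometric polynomials `∑ c_χ E_χ`, where `E_χ φ = exp (i χ̄ₓ φˣ + i χₓ φ̄ˣ)`, given by
their coefficients. -/
abbrev TrigPoly : Type _ := ComplexTest N →₀ ℂ

/-- The Moyal product, the bilinear extension of
`E_ρ ⋆ E_α = exp ((ρ̄ Δ α - ᾱ Δ ρ) / 2) E_(ρ + α)`. -/
def moyalStar (Δ : CovarianceForm N) (F G : TrigPoly N) : TrigPoly N :=
  F.sum fun ρ a => G.sum fun α b =>
    Finsupp.single (ρ + α) (a * b * Complex.exp ((Δ.sesq ρ α - Δ.sesq α ρ) / 2))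

/-- The action of the Weyl quantization of `E_χ`, `χ̄ₓ φˣ` being quantized by multiplication and
`χₓ φ̄ˣ` by the derivative along `Δ χ`:
`Ψ ↦ exp (i χ̄ₓ σˣ - χ̄ Δ χ / 2) Ψ (σ + i Δ χ)`. -/
def weylAction (Δ : CovarianceForm N) (χ : ComplexTest N) (Ψ : ComplexField N → ℂ)
    (σ : ComplexField N) : ℂ :=
  Complex.exp (I * conjPair χ σ - Δ.sesq χ χ / 2) * Ψ (σ + I • Δ.lower χ)

/-- The bounded operator `U` is the Weyl quantization of the trigonometric polynomial `F`. -/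
def IsWeylQuantization (Δ : CovarianceForm N) (F : TrigPoly N) (U : L2Hol μ →L[ℂ] L2Hol μ) : Prop :=
  ∀ Ψ : HidaTest N, ((U (incl μ Ψ) : Lp ℂ 2 μ) : ComplexField N → ℂ)
    =ᵐ[μ] fun σ => F.sum fun χ c => c * weylAction Δ χ Ψ σ

/-- The bounded operator `G` is the Weyl quantization of the Weyl quantizable function (an element
of the completion of the trigonometric polynomials in the norm `‖F‖ = ‖Q(F)‖`) that the
sequence `F` of trigonometric polynomials approximates. -/
def IsWeylLimit (Δ : CovarianceForm N) (F : ℕ → TrigPoly N) (G : L2Hol μ →L[ℂ] L2Hol μ) : Prop :=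
  ∃ U : ℕ → L2Hol μ →L[ℂ] L2Hol μ,
    (∀ n, IsWeylQuantization μ Δ (F n) (U n)) ∧ Tendsto U atTop (𝓝 G)

end Classical

end

/-! There is one analytic point, $\mathscr P\subset L^2(\mu)$; the rest is Hilbert space algebra.

Square integrability combines Minlos' and Fernique's ideas. Nuclearity for the seminorm
$\sqrt{\Delta(x,x)}$ gives $x=\sum c_nf_n(x)y_n$ with $\sum|c_n|<\infty$, $\Delta(y_n,y_n)\le1$ and
$|f_n|\le q$. For almost every field $\phi(x)=\sum c_nf_n(x)\phi(y_n)$ for all $x$, so the norm of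
$\phi$ dual to $q$ is at most $S(\phi)=\sum|c_n||\phi(y_n)|$. The $\phi(y_n)$ are Gaussian with
bounded variance, and Jensen's inequality makes $e^{\delta S^2}$ integrable for some $\delta>0$
(`IsHolomorphicGaussian.exists_expansion`). Growth of minimal type bounds $|\Psi|^2$ by a multiple
of it (`HidaTest.memLp`).

Hence $\mathscr P$ is dense in $L^2_{Hol}(\mu)$, and polarization recovers $\hat G$ from $f_{\hat
G}$ (`quadFun_injective`). The Wirtinger derivatives of $f_{\hat G}$ at $\Psi$ are $\langle\hat
G^*\Psi,\cdot\rangle$ and $\langle\cdot,\hat G\Psi\rangle$, so $K(\partial f_{\hat G},\bar\partial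
f_{\hat H})=\langle\hat G^*\Psi,\hat H\Psi\rangle=f_{\hat G\hat H}(\Psi)$. The bracket is thus the
commutator (`poisson_quadFun`), and the product splits into its symmetric and antisymmetric halves.

For the Moyal product, the Weyl operators preserve $\mathscr P$ and compose with exactly the phase
that defines $\star_m$ (`weylAction_weylAction`). Operator composition is jointly norm continuous,
so the identity passes to limits. -/

set_option linter.unusedSectionVars false

/-! ### One-dimensional marginals of the Gaussian measure -/

section Marginals

open ProbabilityTheory

variable {N : Type*} [AddCommGroup N] [Module ℝ N] [UniformSpace N]

namespace CovarianceForm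

theorem self_nonneg (Δ : CovarianceForm N) (x : N) : 0 ≤ Δ.toForm x x := by
  rcases eq_or_ne x 0 with rfl | hx
  · simp
  · exact (Δ.pos x hx).le

/-- The seminorm `x ↦ √(Δ x x)`. -/
noncomputable def seminorm (Δ : CovarianceForm N) : Seminorm ℝ N :=
  Seminorm.of (fun x => √(Δ.toForm x x))
    (fun x y => by
      have h := LinearMap.BilinForm.apply_mul_apply_le_of_forall_zero_le Δ.toForm Δ.self_nonneg x y
      rw [Δ.symm y x] at h
      have hx := Δ.self_nonneg x
      have hy := Δ.self_nonneg y
      rw [Real.sqrt_le_left (by positivity), add_sq, Real.sq_sqrt hx, Real.sq_sqrt hy]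
      have h2 : Δ.toForm x y ≤ √(Δ.toForm x x) * √(Δ.toForm y y) := by
        rw [← Real.sqrt_mul hx]
        exact Real.le_sqrt_of_sq_le (by rw [sq]; exact h)
      simp only [map_add, LinearMap.add_apply, Δ.symm y x]
      linarith)
    (fun a x => by
      simp only [map_smul, LinearMap.smul_apply, smul_eq_mul, ← mul_assoc]
      rw [Real.sqrt_mul (mul_self_nonneg a), Real.sqrt_mul_self_eq_abs, Real.norm_eq_abs])

theorem seminorm_apply (Δ : CovarianceForm N) (x : N) : Δ.seminorm x = √(Δ.toForm x x) := rfl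

theorem continuous_seminorm (Δ : CovarianceForm N) : Continuous Δ.seminorm :=
  Real.continuous_sqrt.comp (Δ.cont.comp (continuous_id.prodMk continuous_id))

end CovarianceForm

variable [IsUniformAddGroup N] [ContinuousSMul ℝ N]

instance instBorelSpaceComplexField : BorelSpace (ComplexField N) := ⟨rfl⟩

theorem measurable_field_apply (x : N) : Measurable fun φ : ComplexField N => φ x :=
  (continuous_eval_const x).measurable

theorem measurable_field_re (x : N) : Measurable fun φ : ComplexField N => (φ x).re :=
  Complex.measurable_re.comp (measurable_field_apply x)

theorem measurable_field_im (x : N) : Measurable fun φ : ComplexField N => (φ x).im :=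
  Complex.measurable_im.comp (measurable_field_apply x)

variable {Δ : CovarianceForm N} {μ : Measure (ComplexField N)}

/-- Writing the law as a rescaled standard Gaussian puts all marginals over one fixed measure, so
that moment bounds become uniform in the test function. -/
theorem map_eq_gaussian_of_charFun [IsProbabilityMeasure μ] {X : ComplexField N → ℝ}
    (hX : Measurable X) (s : ℝ)
    (h : ∀ t : ℝ, ∫ φ, Complex.exp (t * X φ * I) ∂μ = Complex.exp (-(s ^ 2 * t ^ 2 / 2 : ℝ))) :
    μ.map X = (gaussianReal 0 1).map (s * ·) := by
  have : IsProbabilityMeasure (μ.map X) := Measure.isProbabilityMeasure_map hX.aemeasurable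
  rw [gaussianReal_map_const_mul]
  refine Measure.ext_of_charFun ?_
  funext t
  rw [charFun_apply_real, integral_map hX.aemeasurable (by fun_prop), h, charFun_gaussianReal]
  congr 1
  push_cast
  simp

namespace IsHolomorphicGaussian

theorem integral_exp_re_im (hμ : IsHolomorphicGaussian Δ μ) (a b : N) :
    ∫ φ, Complex.exp (2 * ((φ a).re + (φ b).im : ℝ) * I) ∂μ
      = Complex.exp (-(Δ.toForm a a + Δ.toForm b b : ℝ)) := by
  have h := hμ.charFun (a, b)
  convert h using 3 with φ
  · congr 1
    rw [Complex.add_conj, mul_comm I]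
    simp [conjPair]
  · simp [CovarianceForm.sesq, Δ.symm b a]

theorem map_re (hμ : IsHolomorphicGaussian Δ μ) (a : N) :
    μ.map (fun φ => (φ a).re) = (gaussianReal 0 1).map (Δ.seminorm a / √2 * ·) := by
  have := hμ.isProbability
  refine map_eq_gaussian_of_charFun (measurable_field_re a) _
    fun t => ?_
  have h := hμ.integral_exp_re_im ((t / 2) • a) 0
  convert h using 3 with φ
  · simp; ring_nf
  · simp only [CovarianceForm.seminorm_apply, div_pow, Real.sq_sqrt (Δ.self_nonneg a),
      map_smul, LinearMap.smul_apply, smul_eq_mul, map_zero, add_zero]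
    norm_num
    ring

theorem map_im (hμ : IsHolomorphicGaussian Δ μ) (a : N) :
    μ.map (fun φ => (φ a).im) = (gaussianReal 0 1).map (Δ.seminorm a / √2 * ·) := by
  have := hμ.isProbability
  refine map_eq_gaussian_of_charFun (measurable_field_im a) _
    fun t => ?_
  have h := hμ.integral_exp_re_im 0 ((t / 2) • a)
  convert h using 3 with φ
  · simp; ring_nf
  · simp only [CovarianceForm.seminorm_apply, div_pow, Real.sq_sqrt (Δ.self_nonneg a),
      map_smul, LinearMap.smul_apply, smul_eq_mul, map_zero, zero_add]
    norm_num
    ring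

theorem lintegral_re (hμ : IsHolomorphicGaussian Δ μ) (a : N) {g : ℝ → ENNReal}
    (hg : Measurable g) :
    ∫⁻ φ, g (φ a).re ∂μ = ∫⁻ z, g (Δ.seminorm a / √2 * z) ∂(gaussianReal 0 1) := by
  rw [← lintegral_map hg (measurable_field_re a), hμ.map_re a, lintegral_map hg (by fun_prop)]

theorem lintegral_im (hμ : IsHolomorphicGaussian Δ μ) (a : N) {g : ℝ → ENNReal}
    (hg : Measurable g) :
    ∫⁻ φ, g (φ a).im ∂μ = ∫⁻ z, g (Δ.seminorm a / √2 * z) ∂(gaussianReal 0 1) := by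
  rw [← lintegral_map hg (measurable_field_im a), hμ.map_im a, lintegral_map hg (by fun_prop)]

theorem exists_lintegral_enorm_le (hμ : IsHolomorphicGaussian Δ μ) :
    ∃ M : ENNReal, M ≠ ⊤ ∧ ∀ a : N, ∫⁻ φ, ‖φ a‖ₑ ∂μ ≤ ENNReal.ofReal (Δ.seminorm a) * M := by
  have hfin : ∫⁻ z, ‖z‖ₑ ∂(gaussianReal 0 1) ≠ ⊤ :=
    (((memLp_id_gaussianReal 1).integrable le_rfl).hasFiniteIntegral).ne
  have key : ∀ a : N, ∫⁻ z, ‖Δ.seminorm a / √2 * z‖ₑ ∂(gaussianReal 0 1)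
      ≤ ENNReal.ofReal (Δ.seminorm a) * ∫⁻ z, ‖z‖ₑ ∂(gaussianReal 0 1) := by
    intro a
    simp_rw [enorm_mul]
    rw [lintegral_const_mul _ (by fun_prop)]
    gcongr
    rw [Real.enorm_eq_ofReal (by positivity)]
    exact ENNReal.ofReal_le_ofReal (div_le_self (apply_nonneg _ _) (by norm_num))
  refine ⟨2 * ∫⁻ z, ‖z‖ₑ ∂(gaussianReal 0 1), ENNReal.mul_ne_top (by simp) hfin, fun a => ?_⟩
  calc ∫⁻ φ, ‖φ a‖ₑ ∂μ ≤ ∫⁻ φ, (‖(φ a).re‖ₑ + ‖(φ a).im‖ₑ) ∂μ := by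
        refine lintegral_mono fun φ => ?_
        simp only [← ofReal_norm]
        rw [← ENNReal.ofReal_add (norm_nonneg _) (norm_nonneg _)]
        exact ENNReal.ofReal_le_ofReal (Complex.norm_le_abs_re_add_abs_im _)
    _ = ∫⁻ z, ‖Δ.seminorm a / √2 * z‖ₑ ∂(gaussianReal 0 1)
          + ∫⁻ z, ‖Δ.seminorm a / √2 * z‖ₑ ∂(gaussianReal 0 1) := by
        rw [lintegral_add_left
          (measurable_field_re a).enorm,
          hμ.lintegral_re a measurable_enorm, hμ.lintegral_im a measurable_enorm]
    _ ≤ _ := (add_le_add (key a) (key a)).trans_eq (by ring)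

theorem lintegral_exp_sq_gaussian_ne_top :
    ∫⁻ z, ENNReal.ofReal (Real.exp (z ^ 2 / 4)) ∂(gaussianReal 0 1) ≠ ⊤ := by
  rw [gaussianReal_of_var_ne_zero _ one_ne_zero,
    lintegral_withDensity_eq_lintegral_mul _ (measurable_gaussianPDF _ _) (by fun_prop)]
  have h : Integrable (fun z : ℝ => (√(2 * Real.pi))⁻¹ * Real.exp (-(1 / 4) * z ^ 2)) :=
    (integrable_exp_neg_mul_sq (by norm_num)).const_mul _
  refine ne_of_eq_of_ne (lintegral_congr fun z => ?_) h.lintegral_lt_top.ne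
  rw [Pi.mul_apply, gaussianPDF, gaussianPDFReal, ← ENNReal.ofReal_mul (by positivity), mul_assoc,
    ← Real.exp_add, NNReal.coe_one, mul_one]
  ring_nf

theorem exists_lintegral_exp_sq_le (hμ : IsHolomorphicGaussian Δ μ) :
    ∃ M : ENNReal, M ≠ ⊤ ∧ ∀ a : N, Δ.seminorm a ≤ 1 →
      ∫⁻ φ, ENNReal.ofReal (Real.exp (‖φ a‖ ^ 2 / 4)) ∂μ ≤ M := by
  refine ⟨2 * ∫⁻ z, ENNReal.ofReal (Real.exp (z ^ 2 / 4)) ∂(gaussianReal 0 1),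
    ENNReal.mul_ne_top (by simp) lintegral_exp_sq_gaussian_ne_top, fun a ha => ?_⟩
  -- Real and imaginary parts have variance $\Delta(a,a)/2\le1/2$, so the exponent is at most
  -- $z^2/4$, half of the decay $z^2/2$ of the Gaussian density.
  have key : ∫⁻ z, ENNReal.ofReal (Real.exp ((Δ.seminorm a / √2 * z) ^ 2 / 2)) ∂(gaussianReal 0 1)
      ≤ ∫⁻ z, ENNReal.ofReal (Real.exp (z ^ 2 / 4)) ∂(gaussianReal 0 1) := by
    refine lintegral_mono fun z => ENNReal.ofReal_le_ofReal (Real.exp_le_exp.2 ?_)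
    rw [mul_pow, div_pow, Real.sq_sqrt (by norm_num)]
    have : (Δ.seminorm a) ^ 2 ≤ 1 := pow_le_one₀ (apply_nonneg _ _) ha
    nlinarith [sq_nonneg z]
  calc ∫⁻ φ, ENNReal.ofReal (Real.exp (‖φ a‖ ^ 2 / 4)) ∂μ
      ≤ ∫⁻ φ, (ENNReal.ofReal (Real.exp ((φ a).re ^ 2 / 2))
          + ENNReal.ofReal (Real.exp ((φ a).im ^ 2 / 2))) ∂μ := by
        refine lintegral_mono fun φ => ?_
        dsimp only
        rw [← ENNReal.ofReal_add (by positivity) (by positivity)]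
        apply ENNReal.ofReal_le_ofReal
        rw [Complex.sq_norm, Complex.normSq_apply]
        -- $|\phi(a)|^2$ is at most twice the larger of the two squares; only the two marginals are
        -- needed, not their independence.
        rcases le_total ((φ a).re ^ 2) ((φ a).im ^ 2) with h | h
        · exact (Real.exp_le_exp.2 (by nlinarith)).trans
            (le_add_of_nonneg_left (Real.exp_nonneg _))
        · exact (Real.exp_le_exp.2 (by nlinarith)).trans
            (le_add_of_nonneg_right (Real.exp_nonneg _))
    _ = _ := by
        rw [lintegral_add_left (((measurable_field_re a).pow_const 2).div_const 2).exp.ennreal_ofReal,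
          hμ.lintegral_re a (g := fun x => ENNReal.ofReal (Real.exp (x ^ 2 / 2))) (by fun_prop),
          hμ.lintegral_im a (g := fun x => ENNReal.ofReal (Real.exp (x ^ 2 / 2))) (by fun_prop)]
    _ ≤ _ := (add_le_add key key).trans_eq (by ring)

end IsHolomorphicGaussian

end Marginals

/-! ### Nuclear expansions of Gaussian fields -/

section Expansion

variable {N : Type*} [AddCommGroup N] [Module ℝ N] [UniformSpace N]
  [IsUniformAddGroup N] [ContinuousSMul ℝ N]

/-- A countable neighbourhood basis is refined by balls of seminorms, and the nuclear expansion for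
each of them approximates every vector by combinations of countably many. Countability lets almost
sure identities be imposed on all of `Y` at once. -/
theorem IsNuclearTVS.exists_countable_dense_span [LocallyConvexSpace ℝ N]
    [FirstCountableTopology N] (h : IsNuclearTVS N) :
    ∃ Y : Set N, Y.Countable ∧ Dense (Submodule.span ℝ Y : Set N) := by
  obtain ⟨u, hu⟩ := (𝓝 (0 : N)).exists_antitone_basis
  have hP : ∀ k, ∃ P : Seminorm ℝ N, Continuous P ∧ ∃ r > 0, P.ball 0 r ⊆ u k := by
    intro k
    obtain ⟨s, r, hr, hs⟩ := ((with_gaugeSeminormFamily (𝕜 := ℝ) (E := N)).mem_nhds_iff 0 (u k)).1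
      (hu.1.mem_of_mem trivial)
    exact ⟨_, Seminorm.continuous_finsetSup fun i _ =>
      with_gaugeSeminormFamily.continuous_seminorm i, r, hr, hs⟩
  choose P hPc r hr hPu using hP
  choose q hq c f y hc hf hy hlim using fun k => h (P k) (hPc k)
  refine ⟨⋃ k, Set.range (y k), Set.countable_iUnion fun k => Set.countable_range _, fun x => ?_⟩
  rw [mem_closure_iff_nhds]
  intro U hU
  have hU' : (fun w => x - w) ⁻¹' U ∈ 𝓝 (0 : N) :=
    (continuous_const.sub continuous_id).continuousAt.preimage_mem_nhds (by simpa using hU)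
  obtain ⟨k, -, hk⟩ := hu.1.mem_iff.1 hU'
  obtain ⟨n, hn⟩ := ((hlim k x).eventually (gt_mem_nhds (hr k))).exists
  refine ⟨∑ i ∈ Finset.range n, (c k i * f k i x) • y k i, ?_, ?_⟩
  · have := hk (hPu k (by simpa [Seminorm.mem_ball] using hn))
    simpa using this
  · exact Submodule.sum_mem _ fun i _ => Submodule.smul_mem _ _
      (Submodule.subset_span (Set.mem_iUnion.2 ⟨k, i, rfl⟩))

theorem norm_expansion_term_le {c : ℕ → ℝ} {f : ℕ → N →L[ℝ] ℝ} {q : Seminorm ℝ N}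
    (hf : ∀ n x, |f n x| ≤ q x) (n : ℕ) (x : N) (z : ℂ) :
    ‖((c n * f n x : ℝ) : ℂ) * z‖ ≤ |c n| * ‖z‖ * q x := by
  rw [norm_mul, Complex.norm_real, Real.norm_eq_abs, abs_mul]
  nlinarith [mul_le_mul_of_nonneg_left (hf n x) (mul_nonneg (abs_nonneg (c n)) (norm_nonneg z))]

/-- If a nuclear expansion represents `φ` on a set with dense span, it represents `φ` everywhere. -/
theorem field_hasSum_of_dense {c : ℕ → ℝ} {f : ℕ → N →L[ℝ] ℝ} {y : ℕ → N} {q : Seminorm ℝ N}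
    (hq : Continuous q) (hf : ∀ n x, |f n x| ≤ q x) {φ : ComplexField N}
    (hs : Summable fun n => |c n| * ‖φ (y n)‖) {Y : Set N}
    (hY : Dense (Submodule.span ℝ Y : Set N))
    (h : ∀ x ∈ Y, φ x = ∑' n, ((c n * f n x : ℝ) : ℂ) * φ (y n)) (x : N) :
    HasSum (fun n => ((c n * f n x : ℝ) : ℂ) * φ (y n)) (φ x) := by
  have hb : ∀ n x, ‖((c n * f n x : ℝ) : ℂ) * φ (y n)‖ ≤ q x * (|c n| * ‖φ (y n)‖) := fun n x =>
    (norm_expansion_term_le hf n x _).trans_eq (mul_comm _ _)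
  have hsum : ∀ x, Summable fun n => ((c n * f n x : ℝ) : ℂ) * φ (y n) := fun x =>
    Summable.of_norm_bounded (hs.mul_left (q x)) fun n => hb n x
  let L : N →ₗ[ℝ] ℂ :=
    { toFun := fun x => ∑' n, ((c n * f n x : ℝ) : ℂ) * φ (y n)
      map_add' := fun a b => by
        rw [← (hsum a).tsum_add (hsum b)]
        refine tsum_congr fun n => ?_
        rw [map_add]; push_cast; ring
      map_smul' := fun r a => by
        rw [RingHom.id_apply, ← tsum_const_smul'']
        refine tsum_congr fun n => ?_
        simp only [map_smul, smul_eq_mul, Complex.real_smul]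
        push_cast; ring }
  have hLb : ∀ x, ‖L x‖ ≤ q x * ∑' n, |c n| * ‖φ (y n)‖ := fun x => by
    rw [← tsum_mul_left]
    exact tsum_of_norm_bounded (hs.mul_left (q x)).hasSum fun n => hb n x
  have hL : Continuous L := by
    refine continuous_of_continuousAt_zero L ?_
    rw [ContinuousAt, map_zero]
    refine squeeze_zero_norm hLb ?_
    have := (hq.tendsto 0).mul_const (∑' n, |c n| * ‖φ (y n)‖)
    simpa using this
  have hEq : Set.EqOn φ.toLinearMap L (Submodule.span ℝ Y : Set N) :=
    LinearMap.eqOn_span h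
  have : (φ : N → ℂ) = L := Continuous.ext_on hY φ.continuous hL hEq
  rw [show φ x = L x from congrFun this x]
  exact (hsum x).hasSum

variable {Δ : CovarianceForm N} {μ : Measure (ComplexField N)}

/-- A nuclear expansion that converges in the covariance seminorm represents the Gaussian field
almost everywhere. -/
theorem IsHolomorphicGaussian.ae_eq_tsum (hμ : IsHolomorphicGaussian Δ μ)
    {c : ℕ → ℝ} {f : ℕ → N →L[ℝ] ℝ} {y : ℕ → N} {q : Seminorm ℝ N}
    (hf : ∀ n x, |f n x| ≤ q x)
    (hs : ∀ᵐ φ ∂μ, Summable fun n => |c n| * ‖φ (y n)‖) (x : N)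
    (hlim : Tendsto (fun k : ℕ => Δ.seminorm (x - ∑ n ∈ Finset.range k, (c n * f n x) • y n))
      atTop (𝓝 0)) :
    ∀ᵐ φ ∂μ, φ x = ∑' n, ((c n * f n x : ℝ) : ℂ) * φ (y n) := by
  obtain ⟨M, hM, hle⟩ := hμ.exists_lintegral_enorm_le
  set s : ℕ → N := fun k => ∑ n ∈ Finset.range k, (c n * f n x) • y n with hsdef
  -- Convergence in the covariance seminorm is convergence in $L^1(\mu)$; Fatou's lemma makes the
  -- lower limit vanish almost everywhere. Summability shows that the pointwise limit exists, so it
  -- is zero and no subsequence is needed.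
  have h0 : ∫⁻ φ, liminf (fun k => ‖φ (x - s k)‖ₑ) atTop ∂μ = 0 := by
    refine le_antisymm ?_ bot_le
    refine (lintegral_liminf_le fun k => (measurable_field_apply _).enorm).trans ?_
    have ht : Tendsto (fun k => ENNReal.ofReal (Δ.seminorm (x - s k)) * M) atTop (𝓝 0) := by
      have := ENNReal.Tendsto.mul_const (b := M) (ENNReal.tendsto_ofReal hlim) (Or.inr hM)
      simpa using this
    exact (liminf_le_liminf (Eventually.of_forall fun k => hle _)).trans ht.liminf_eq.le
  rw [lintegral_eq_zero_iff (Measurable.liminf fun k => (measurable_field_apply _).enorm)] at h0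
  filter_upwards [h0, hs] with φ hφ hsφ
  have hsum : Summable fun n => ((c n * f n x : ℝ) : ℂ) * φ (y n) := by
    exact Summable.of_norm_bounded (hsφ.mul_right (q x)) fun n => norm_expansion_term_le hf n x _
  have hφs : ∀ k, φ (x - s k) = φ x - ∑ n ∈ Finset.range k, ((c n * f n x : ℝ) : ℂ) * φ (y n) := by
    intro k
    simp [hsdef, map_sub, map_sum, Complex.real_smul]
  have ht : Tendsto (fun k => ‖φ (x - s k)‖ₑ) atTop
      (𝓝 ‖φ x - ∑' n, ((c n * f n x : ℝ) : ℂ) * φ (y n)‖ₑ) := by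
    simp_rw [hφs]
    exact (tendsto_const_nhds.sub hsum.hasSum.tendsto_sum_nat).enorm
  have : ‖φ x - ∑' n, ((c n * f n x : ℝ) : ℂ) * φ (y n)‖ₑ = 0 := by
    rw [← ht.liminf_eq]; exact hφ
  exact sub_eq_zero.1 (enorm_eq_zero.1 this)

/-- An infinite form of Jensen's inequality for `x ↦ exp (x ^ 2 / 4)` and a subprobability. -/
theorem exp_sq_tsum_le {w z : ℕ → ℝ} (hw : ∀ n, 0 ≤ w n) (hw1 : Summable w) (hw2 : ∑' n, w n ≤ 1)
    (hz : ∀ n, 0 ≤ z n) (hs : Summable fun n => w n * Real.exp (z n ^ 2 / 4)) :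
    Summable (fun n => w n * z n) ∧
      Real.exp ((∑' n, w n * z n) ^ 2 / 4) ≤ 1 + ∑' n, w n * Real.exp (z n ^ 2 / 4) := by
  have hz1 : Summable fun n => w n * z n := by
    refine Summable.of_nonneg_of_le (fun n => mul_nonneg (hw n) (hz n)) (fun n => ?_) hs
    refine mul_le_mul_of_nonneg_left ?_ (hw n)
    nlinarith [Real.add_one_le_exp (z n ^ 2 / 4), sq_nonneg (z n - 2)]
  refine ⟨hz1, ?_⟩
  set s := ∑' n, w n * z n with hsd
  set W := ∑' n, w n with hW
  set E := ∑' n, w n * Real.exp (z n ^ 2 / 4) with hE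
  have hW0 : 0 ≤ W := tsum_nonneg hw
  set A := Real.exp (s ^ 2 / 4) with hA
  have hA1 : 0 < A := Real.exp_pos _
  -- The tangent of $x\mapsto e^{x^2/4}$ at $s$ lies below the graph.
  have hterm : ∀ n, A * (w n * (1 - s ^ 2 / 2) + (w n * z n) * (s / 2))
      ≤ w n * Real.exp (z n ^ 2 / 4) := by
    intro n
    have h1 : Real.exp (z n ^ 2 / 4) = A * Real.exp (z n ^ 2 / 4 - s ^ 2 / 4) := by
      rw [hA, ← Real.exp_add]; ring_nf
    rw [h1]
    have h2 : 1 - s ^ 2 / 2 + z n * (s / 2) ≤ Real.exp (z n ^ 2 / 4 - s ^ 2 / 4) := by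
      nlinarith [Real.add_one_le_exp (z n ^ 2 / 4 - s ^ 2 / 4), sq_nonneg (z n - s)]
    nlinarith [mul_le_mul_of_nonneg_left h2 (mul_nonneg hA1.le (hw n))]
  have hle : A * (W * (1 - s ^ 2 / 2) + s * (s / 2)) ≤ E := by
    rw [hW, hsd, ← tsum_mul_right, ← hsd, hsd, ← tsum_mul_right, ← hsd,
      ← (hw1.mul_right _).tsum_add (hz1.mul_right _), ← tsum_mul_left]
    exact Summable.tsum_le_tsum hterm (((hw1.mul_right _).add (hz1.mul_right _)).mul_left _) hs
  have hfin : A * (1 - s ^ 2 / 2) ≤ 1 := by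
    have h3 : 1 - s ^ 2 / 2 ≤ Real.exp (-(s ^ 2 / 4)) := by
      nlinarith [Real.add_one_le_exp (-(s ^ 2 / 4)), sq_nonneg s]
    have h4 : A * Real.exp (-(s ^ 2 / 4)) = 1 := by rw [hA, ← Real.exp_add]; simp
    nlinarith
  -- The missing mass $1-W$ acts as a point mass at $0$, where the function is $1$; `hfin` is the
  -- tangent inequality there.
  have hWm : (1 - W) * (A * (1 - s ^ 2 / 2)) ≤ 1 - W := by nlinarith
  nlinarith

end Expansion

/-! ### Square integrability of Hida test functions -/

section SquareIntegrability

variable {N : Type*} [AddCommGroup N] [Module ℝ N] [UniformSpace N]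
  [IsUniformAddGroup N] [ContinuousSMul ℝ N]
  {Δ : CovarianceForm N} {μ : Measure (ComplexField N)}

/-- The Gaussian field has a nuclear expansion with a square exponentially integrable bound. -/
theorem IsHolomorphicGaussian.exists_expansion [IsNuclearFrechet N]
    (hμ : IsHolomorphicGaussian Δ μ) :
    ∃ (c : ℕ → ℝ) (f : ℕ → N →L[ℝ] ℝ) (y : ℕ → N) (q : Seminorm ℝ N) (δ : ℝ),
      Continuous q ∧ (∀ n x, |f n x| ≤ q x) ∧
      (∀ᵐ φ ∂μ, (Summable fun n => |c n| * ‖φ (y n)‖) ∧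
        ∀ x, HasSum (fun n => ((c n * f n x : ℝ) : ℂ) * φ (y n)) (φ x)) ∧
      0 < δ ∧
      ∫⁻ φ, ENNReal.ofReal (Real.exp (δ * (∑' n, |c n| * ‖φ (y n)‖) ^ 2)) ∂μ ≠ ⊤ := by
  have := IsNuclearFrechet.locallyConvex (N := N)
  have := IsNuclearFrechet.firstCountable (N := N)
  have := hμ.isProbability
  have hnuc := IsNuclearFrechet.nuclear (N := N)
  obtain ⟨Y, hYc, hY⟩ := hnuc.exists_countable_dense_span
  obtain ⟨q, hq, c, f, y, hc, hf, hy, hlim⟩ := hnuc Δ.seminorm Δ.continuous_seminorm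
  obtain ⟨M, hM, hle⟩ := hμ.exists_lintegral_exp_sq_le
  -- The summand $1$ keeps the normalization positive when all $c_n$ vanish; the weights $|c_n|/C$
  -- then form only a subprobability.
  set C : ℝ := 1 + ∑' n, |c n| with hC
  have hC0 : 0 < C := add_pos_of_pos_of_nonneg one_pos (tsum_nonneg fun n => abs_nonneg _)
  have hw0 : ∀ n, 0 ≤ |c n| / C := fun n => by positivity
  have hw1 : Summable fun n => |c n| / C := hc.div_const C
  have hw2 : ∑' n, |c n| / C ≤ 1 := by
    rw [tsum_div_const, div_le_one hC0, hC]; linarith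
  have hmeas : ∀ n, Measurable fun φ : ComplexField N =>
      ENNReal.ofReal (|c n| / C * Real.exp (‖φ (y n)‖ ^ 2 / 4)) := fun n =>
    ((((measurable_field_apply (y n)).norm.pow_const 2).div_const 4).exp.const_mul _).ennreal_ofReal
  have hint : ∫⁻ φ, ∑' n, ENNReal.ofReal (|c n| / C * Real.exp (‖φ (y n)‖ ^ 2 / 4)) ∂μ ≠ ⊤ := by
    rw [lintegral_tsum fun n => (hmeas n).aemeasurable]
    have hb : ∀ n, ∫⁻ φ, ENNReal.ofReal (|c n| / C * Real.exp (‖φ (y n)‖ ^ 2 / 4)) ∂μ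
        ≤ ENNReal.ofReal (|c n| / C) * M := by
      intro n
      simp_rw [ENNReal.ofReal_mul (hw0 n)]
      rw [lintegral_const_mul _
        (((measurable_field_apply (y n)).norm.pow_const 2).div_const 4).exp.ennreal_ofReal]
      exact mul_le_mul_right (hle _ (hy n)) _
    refine ne_top_of_le_ne_top ?_ (ENNReal.tsum_le_tsum hb)
    rw [ENNReal.tsum_mul_right]
    exact ENNReal.mul_ne_top hw1.tsum_ofReal_ne_top hM
  have hae : ∀ᵐ φ ∂μ, Summable fun n => |c n| / C * Real.exp (‖φ (y n)‖ ^ 2 / 4) := by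
    filter_upwards [ae_lt_top (Measurable.tsum hmeas) hint] with φ hφ
    refine (ENNReal.summable_toReal hφ.ne).congr fun n => ?_
    exact ENNReal.toReal_ofReal (by positivity)
  have hscale : ∀ φ : ComplexField N, ∀ n, |c n| * ‖φ (y n)‖ = C * (|c n| / C * ‖φ (y n)‖) := by
    intro φ n; field_simp
  have hsum : ∀ᵐ φ ∂μ, Summable fun n => |c n| * ‖φ (y n)‖ := by
    filter_upwards [hae] with φ hφ
    simp_rw [hscale φ]
    exact (exp_sq_tsum_le hw0 hw1 hw2 (fun n => norm_nonneg _) hφ).1.mul_left C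
  -- With $S=C\sum w_nz_n$, $w_n=|c_n|/C$ and $z_n=|\phi(y_n)|$, this $\delta$ gives $\delta
  -- S^2=(\sum w_nz_n)^2/4$, the exponent in `exp_sq_tsum_le`.
  refine ⟨c, f, y, q, 1 / (4 * C ^ 2), hq, hf, ?_, by positivity, ?_⟩
  · have hYae : ∀ᵐ φ ∂μ, ∀ x ∈ Y, φ x = ∑' n, ((c n * f n x : ℝ) : ℂ) * φ (y n) :=
      (ae_ball_iff hYc).2 fun x _ => hμ.ae_eq_tsum hf hsum x (hlim x)
    filter_upwards [hsum, hYae] with φ h1 h2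
    exact ⟨h1, field_hasSum_of_dense hq hf h1 hY h2⟩
  · refine ne_top_of_le_ne_top (ENNReal.add_ne_top.2 ⟨ENNReal.one_ne_top, hint⟩)
      (b := 1 + _) ?_
    have h1 : (1 : ENNReal) = ∫⁻ _, 1 ∂μ := by simp
    rw [h1, ← lintegral_add_left measurable_const]
    refine lintegral_mono_ae ?_
    filter_upwards [hae] with φ hφ
    have h2 := (exp_sq_tsum_le hw0 hw1 hw2 (fun n => norm_nonneg _) hφ).2
    rw [← ENNReal.ofReal_tsum_of_nonneg (fun n => by positivity) hφ, ← ENNReal.ofReal_one,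
      ← ENNReal.ofReal_add zero_le_one (tsum_nonneg fun n => by positivity)]
    refine ENNReal.ofReal_le_ofReal (le_trans (le_of_eq ?_) h2)
    simp_rw [hscale φ]
    rw [tsum_mul_left]
    congr 1
    field_simp

namespace HidaTest

/-- This is the Schwarz lemma on the complex line through $\phi$ and $\psi$: for $|z|<1/\delta$ the
point $\phi+z(\psi-\phi)$ keeps dual norm at most $R+1$, where $\Psi$ is bounded by $M$, and $\psi$
sits at $z=1$. -/
theorem exists_lipschitz_bound (Ψ : HidaTest N) {q : Seminorm ℝ N} (hq : Continuous q)
    {φ : ComplexField N} {R : ℝ} (hR : 0 ≤ R) (hφ : ∀ ξ, ‖φ ξ‖ ≤ R * q ξ) :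
    ∃ L : ℝ, 0 ≤ L ∧ ∀ (ψ : ComplexField N) (δ : ℝ), 0 < δ → δ < 1 →
      (∀ ξ, ‖ψ ξ - φ ξ‖ ≤ δ * q ξ) →
        ‖(Ψ : ComplexField N → ℂ) ψ - (Ψ : ComplexField N → ℂ) φ‖ ≤ L * δ := by
  obtain ⟨hhol, hgrowth⟩ := Ψ.2
  obtain ⟨C, hC⟩ := hgrowth q hq 1 one_pos
  set M := C * Real.exp (1 * (R + 1) ^ 2) with hM
  have hbd : ∀ ψ : ComplexField N, (∀ ξ, ‖ψ ξ‖ ≤ (R + 1) * q ξ) →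
      ‖(Ψ : ComplexField N → ℂ) ψ‖ ≤ M := fun ψ h => hC ψ (R + 1) (by positivity) h
  have hφ1 : ∀ ξ, ‖φ ξ‖ ≤ (R + 1) * q ξ := fun ξ =>
    (hφ ξ).trans (by nlinarith [apply_nonneg q ξ])
  have hM0 : 0 ≤ M := (norm_nonneg _).trans (hbd φ hφ1)
  refine ⟨2 * M, by positivity, fun ψ δ hδ hδ1 hψ => ?_⟩
  set g : ℂ → ℂ := fun z => (Ψ : ComplexField N → ℂ) (φ + z • (ψ - φ)) with hg
  have hg0 : g 0 = (Ψ : ComplexField N → ℂ) φ := by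
    refine congrArg (Ψ : ComplexField N → ℂ) ?_
    ext ξ
    simp
  have hg1 : g 1 = (Ψ : ComplexField N → ℂ) ψ := by simp [hg]
  have hmaps : Set.MapsTo g (Metric.ball 0 (1 / δ)) (Metric.closedBall (g 0) (2 * M)) := by
    intro z hz
    rw [mem_ball_zero_iff, lt_div_iff₀ hδ] at hz
    rw [mem_closedBall_iff_norm, hg0]
    refine (norm_sub_le _ _).trans ?_
    have h1 := hbd (φ + z • (ψ - φ)) fun ξ => by
      have hn : ‖z * (ψ ξ - φ ξ)‖ ≤ q ξ := by
        rw [norm_mul]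
        nlinarith [hψ ξ, norm_nonneg z, apply_nonneg q ξ,
          mul_le_mul_of_nonneg_left (hψ ξ) (norm_nonneg z)]
      have : (φ + z • (ψ - φ)) ξ = φ ξ + z * (ψ ξ - φ ξ) := by simp
      rw [this]
      exact (norm_add_le _ _).trans (by linarith [hφ ξ])
    linarith [hbd φ hφ1]
  have h := Complex.dist_le_div_mul_dist_of_mapsTo_ball (f := g) (c := 0) (z := 1)
    ((hhol φ (ψ - φ)).differentiableOn) hmaps
    (by rw [mem_ball_zero_iff, norm_one]; exact (one_lt_div hδ).2 hδ1)
  rw [hg0, hg1, dist_eq_norm, dist_zero_right, norm_one, mul_one] at h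
  simpa using h

/-- Hida test functions are continuous for the dual norms of continuous seminorms. -/
theorem tendsto_of_dual_bound (Ψ : HidaTest N) {q : Seminorm ℝ N} (hq : Continuous q)
    {φ : ComplexField N} {R : ℝ} (hR : 0 ≤ R) (hφ : ∀ ξ, ‖φ ξ‖ ≤ R * q ξ)
    {ι : Type*} {l : Filter ι} {ψ : ι → ComplexField N} {δ : ι → ℝ}
    (hψ : ∀ i ξ, ‖ψ i ξ - φ ξ‖ ≤ δ i * q ξ) (hδ : Tendsto δ l (𝓝 0)) :
    Tendsto (fun i => (Ψ : ComplexField N → ℂ) (ψ i)) l (𝓝 ((Ψ : ComplexField N → ℂ) φ)) := by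
  obtain ⟨L, hL0, hL⟩ := exists_lipschitz_bound Ψ hq hR hφ
  rw [Metric.tendsto_nhds]
  intro e he
  set η := min (1 / 2) (e / (2 * (L + 1))) with hη
  have hη0 : 0 < η := by positivity
  have hη1 : η < 1 := (min_le_left _ _).trans_lt (by norm_num)
  have hηe : L * η < e := by
    have h1 : η * (2 * (L + 1)) ≤ e := by
      rw [← le_div_iff₀ (by positivity)]; exact min_le_right _ _
    nlinarith
  filter_upwards [hδ.eventually (gt_mem_nhds hη0)] with i hi
  rw [dist_eq_norm]
  -- The bound is applied with $\eta$ because `δ i` need not be positive.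
  exact (hL (ψ i) η hη0 hη1 fun ξ =>
    (hψ i ξ).trans (mul_le_mul_of_nonneg_right hi.le (apply_nonneg q ξ))).trans_lt hηe

/-- The field `∑ n < k, c n • z n • f n`. -/
noncomputable def partialField (c : ℕ → ℝ) (f : ℕ → N →L[ℝ] ℝ) (k : ℕ) (z : ℕ → ℂ) :
    ComplexField N :=
  ∑ n ∈ Finset.range k, (f n).smulRight ((c n : ℂ) * z n)

theorem partialField_apply (c : ℕ → ℝ) (f : ℕ → N →L[ℝ] ℝ) (k : ℕ) (z : ℕ → ℂ) (x : N) :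
    partialField c f k z x = ∑ n ∈ Finset.range k, ((c n * f n x : ℝ) : ℂ) * z n := by
  simp only [partialField, _root_.sum_apply, ContinuousLinearMap.smulRight_apply,
    Complex.real_smul]
  refine Finset.sum_congr rfl fun n _ => ?_
  push_cast; ring

theorem norm_partialField_le {c : ℕ → ℝ} {f : ℕ → N →L[ℝ] ℝ} {q : Seminorm ℝ N}
    (hf : ∀ n x, |f n x| ≤ q x) (k : ℕ) (z : ℕ → ℂ) (x : N) :
    ‖partialField c f k z x‖ ≤ (∑ n ∈ Finset.range k, |c n| * ‖z n‖) * q x := by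
  rw [partialField_apply, Finset.sum_mul]
  exact norm_sum_le_of_le _ fun n _ => norm_expansion_term_le hf n x (z n)

theorem continuous_comp_partialField (Ψ : HidaTest N) {c : ℕ → ℝ} {f : ℕ → N →L[ℝ] ℝ}
    {q : Seminorm ℝ N} (hq : Continuous q) (hf : ∀ n x, |f n x| ≤ q x) (k : ℕ) :
    Continuous fun z => (Ψ : ComplexField N → ℂ) (partialField c f k z) := by
  rw [continuous_iff_continuousAt]
  intro z₀
  refine tendsto_of_dual_bound Ψ hq (Finset.sum_nonneg fun n _ => by positivity)
    (norm_partialField_le hf k z₀)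
    (δ := fun z => ∑ n ∈ Finset.range k, |c n| * ‖z n - z₀ n‖) (fun z ξ => ?_) ?_
  · have h := norm_partialField_le (c := c) hf k (fun n => z n - z₀ n) ξ
    convert h using 2
    simp only [partialField_apply, mul_sub, Finset.sum_sub_distrib]
  · have hc : Continuous fun z : ℕ → ℂ => ∑ n ∈ Finset.range k, |c n| * ‖z n - z₀ n‖ := by
      fun_prop
    simpa using hc.tendsto z₀

theorem memLp [IsNuclearFrechet N] (hμ : IsHolomorphicGaussian Δ μ) (Ψ : HidaTest N) :
    MemLp (Ψ : ComplexField N → ℂ) 2 μ := by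
  obtain ⟨c, f, y, q, δ, hq, hf, hae, hδ, hint⟩ := hμ.exists_expansion
  have hbound : ∀ φ : ComplexField N, (Summable fun n => |c n| * ‖φ (y n)‖) →
      (∀ x, HasSum (fun n => ((c n * f n x : ℝ) : ℂ) * φ (y n)) (φ x)) →
      ∀ x, ‖φ x‖ ≤ (∑' n, |c n| * ‖φ (y n)‖) * q x := by
    intro φ hs h x
    rw [← (h x).tsum_eq, ← tsum_mul_right]
    exact tsum_of_norm_bounded (hs.mul_right (q x)).hasSum fun n =>
      norm_expansion_term_le hf n x _
  -- Borel measurability of $\Psi$ is not assumed. Along the truncated expansions it is a continuous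
  -- function of countably many evaluations, and these converge to $\Psi$ almost everywhere.
  have hmeas : AEStronglyMeasurable (Ψ : ComplexField N → ℂ) μ := by
    refine aestronglyMeasurable_of_tendsto_ae atTop
      (f := fun k φ => (Ψ : ComplexField N → ℂ) (partialField c f k fun n => φ (y n)))
      (fun k => ?_) ?_
    · exact ((continuous_comp_partialField Ψ hq hf k).measurable.comp
        (measurable_pi_lambda _ fun n => measurable_field_apply (y n))).aestronglyMeasurable
    · filter_upwards [hae] with φ ⟨hs, h⟩
      refine tendsto_of_dual_bound Ψ hq (tsum_nonneg fun n => by positivity) (hbound φ hs h)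
        (δ := fun k => ∑' n, |c (n + k)| * ‖φ (y (n + k))‖) (fun k ξ => ?_)
        (tendsto_sum_nat_add fun n => |c n| * ‖φ (y n)‖)
      have hsk : Summable fun n => |c (n + k)| * ‖φ (y (n + k))‖ :=
        (summable_nat_add_iff k).2 hs
      rw [partialField_apply, norm_sub_rev, ← (h ξ).tsum_eq,
        ← (h ξ).summable.sum_add_tsum_nat_add k, add_sub_cancel_left, ← tsum_mul_right]
      exact tsum_of_norm_bounded (hsk.mul_right (q ξ)).hasSum fun n =>
        norm_expansion_term_le hf (n + k) ξ _
  rw [memLp_two_iff_integrable_sq_norm hmeas]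
  -- Squaring doubles the exponent, hence $\delta/2$.
  obtain ⟨C, hC⟩ := Ψ.2.2 q hq (δ / 2) (by positivity)
  refine ⟨(hmeas.norm.pow 2), ?_⟩
  refine lt_of_le_of_lt ?_ (ENNReal.mul_ne_top (ENNReal.ofReal_ne_top (r := C ^ 2)) hint).lt_top
  rw [← lintegral_const_mul' _ _ ENNReal.ofReal_ne_top]
  refine lintegral_mono_ae ?_
  filter_upwards [hae] with φ ⟨hs, h⟩
  have h1 := hC φ _ (tsum_nonneg fun n => by positivity) (hbound φ hs h)
  rw [Real.enorm_eq_ofReal (by positivity), ← ENNReal.ofReal_mul (by positivity)]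
  refine ENNReal.ofReal_le_ofReal ((pow_le_pow_left₀ (norm_nonneg _) h1 2).trans_eq ?_)
  rw [mul_pow, ← Real.exp_nat_mul]
  congr 2
  push_cast; ring

end HidaTest

end SquareIntegrability

/-! ### Quadratic functions, Poisson bracket and Jordan product -/

section Quantization

variable {N : Type*} [AddCommGroup N] [Module ℝ N] [UniformSpace N]
  [IsUniformAddGroup N] [ContinuousSMul ℝ N]
  {Δ : CovarianceForm N} {μ : Measure (ComplexField N)}

theorem coeFn_incl {Ψ : HidaTest N} (h : MemLp (Ψ : ComplexField N → ℂ) 2 μ) :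
    ((incl μ Ψ : Lp ℂ 2 μ) : ComplexField N → ℂ) =ᵐ[μ] Ψ := by
  simp only [incl, classL2, dif_pos h]
  exact h.coeFn_toLp

theorem incl_eq_of_ae_eq {Ψ : HidaTest N} (h : MemLp (Ψ : ComplexField N → ℂ) 2 μ) {u : L2Hol μ}
    (hu : ((u : Lp ℂ 2 μ) : ComplexField N → ℂ) =ᵐ[μ] Ψ) : u = incl μ Ψ :=
  Subtype.ext (Lp.ext (hu.trans (coeFn_incl h).symm))

namespace L2Hol

theorem inner_smul_right (a b : L2Hol μ) (c : ℂ) : ⟪a, c • b⟫_ℂ = c * ⟪a, b⟫_ℂ :=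
  _root_.inner_smul_right a b c

theorem inner_smul_left (a b : L2Hol μ) (c : ℂ) :
    ⟪c • a, b⟫_ℂ = starRingEnd ℂ c * ⟪a, b⟫_ℂ :=
  _root_.inner_smul_left a b c

theorem inner_conj_symm (a b : L2Hol μ) : starRingEnd ℂ ⟪b, a⟫_ℂ = ⟪a, b⟫_ℂ :=
  _root_.inner_conj_symm a b

end L2Hol

section Algebra

variable (hL : ∀ Ψ : HidaTest N, MemLp (Ψ : ComplexField N → ℂ) 2 μ)

include hL

theorem incl_add (Ψ Φ : HidaTest N) : incl μ (Ψ + Φ) = incl μ Ψ + incl μ Φ := by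
  refine (incl_eq_of_ae_eq (hL _) ?_).symm
  filter_upwards [Lp.coeFn_add (incl μ Ψ : Lp ℂ 2 μ) (incl μ Φ), coeFn_incl (hL Ψ),
    coeFn_incl (hL Φ)] with φ h h1 h2
  rw [Submodule.coe_add, h, Pi.add_apply, h1, h2]
  rfl

theorem incl_smul (c : ℂ) (Ψ : HidaTest N) : incl μ (c • Ψ) = c • incl μ Ψ := by
  refine (incl_eq_of_ae_eq (hL _) ?_).symm
  filter_upwards [Lp.coeFn_smul c (incl μ Ψ : Lp ℂ 2 μ), coeFn_incl (hL Ψ)] with φ h h1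
  rw [Submodule.coe_smul, h, Pi.smul_apply, h1]
  rfl

/-- The Hilbert space is the closure of a span, but the classes of test functions already form a
subspace because the class map is linear on square integrable functions. -/
theorem denseRange_incl : DenseRange (incl μ : HidaTest N → L2Hol μ) := by
  let J : HidaTest N →ₗ[ℂ] Lp ℂ 2 μ :=
    { toFun := fun Ψ => (incl μ Ψ : Lp ℂ 2 μ)
      map_add' := fun Ψ Φ => by rw [incl_add hL]; rfl
      map_smul' := fun c Ψ => by rw [incl_smul hL]; rfl }
  have hspan : (Submodule.span ℂ (Set.range fun Ψ : HidaTest N => classL2 μ Ψ) : Set (Lp ℂ 2 μ))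
      = Set.range fun Ψ : HidaTest N => classL2 μ Ψ := by
    have : (Set.range fun Ψ : HidaTest N => classL2 μ Ψ) = (LinearMap.range J : Set _) := rfl
    rw [this, Submodule.span_eq]
  intro u
  rw [closure_subtype, ← Set.range_comp]
  have hu : (u : Lp ℂ 2 μ) ∈ closure
      (Submodule.span ℂ (Set.range fun Ψ : HidaTest N => classL2 μ Ψ) : Set (Lp ℂ 2 μ)) := u.2
  rw [hspan] at hu
  exact hu

theorem quadFun_eq_inner (G : L2Hol μ →L[ℂ] L2Hol μ) (Ψ : HidaTest N) :
    quadFun G Ψ = ⟪incl μ Ψ, G (incl μ Ψ)⟫_ℂ := by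
  rw [Submodule.coe_inner, L2.inner_def, quadFun]
  refine integral_congr_ae ?_
  filter_upwards [coeFn_incl (hL Ψ)] with φ h
  rw [RCLike.inner_apply, h, mul_comm]

theorem eq_of_inner_incl {a b : L2Hol μ} (h : ∀ v, ⟪a, incl μ v⟫_ℂ = ⟪b, incl μ v⟫_ℂ) : a = b :=
  Dense.eq_of_inner_left ℂ (denseRange_incl hL) fun _ ⟨w, hw⟩ => hw ▸ h w

/-- By density and continuity the forms $\langle u,\hat Gu\rangle$ and $\langle u,\hat Hu\rangle$
agree for all $u$; complex polarization then works without self-adjointness. -/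
theorem quadFun_injective {G H : L2Hol μ →L[ℂ] L2Hol μ} (h : quadFun G = quadFun H) : G = H := by
  have h1 : ∀ u, ⟪u, G u⟫_ℂ = ⟪u, H u⟫_ℂ :=
    congrFun ((denseRange_incl hL).equalizer (continuous_id.inner G.continuous)
      (continuous_id.inner H.continuous) (funext fun Ψ =>
        (quadFun_eq_inner hL G Ψ).symm.trans ((congrFun h Ψ).trans (quadFun_eq_inner hL H Ψ))))
  refine ContinuousLinearMap.coe_injective
    ((ext_inner_map (G : L2Hol μ →ₗ[ℂ] L2Hol μ) H).1 fun u => ?_)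
  exact (L2Hol.inner_conj_symm _ _).symm.trans
    ((congrArg _ (h1 u)).trans (L2Hol.inner_conj_symm _ _))

theorem symbolOp_quadFun (G : L2Hol μ →L[ℂ] L2Hol μ) : symbolOp μ (quadFun G) = G := by
  have h : ∃ H : L2Hol μ →L[ℂ] L2Hol μ, quadFun G = quadFun H := ⟨G, rfl⟩
  rw [symbolOp, dif_pos h]
  exact (quadFun_injective hL h.choose_spec).symm

theorem moyalMul_quadFun (G H : L2Hol μ →L[ℂ] L2Hol μ) :
    moyalMul μ (quadFun G) (quadFun H) = quadFun (G ∘L H) := by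
  rw [moyalMul, symbolOp_quadFun hL, symbolOp_quadFun hL]

theorem quadFun_add (G H : L2Hol μ →L[ℂ] L2Hol μ) :
    quadFun (G + H) = quadFun G + quadFun H := by
  funext Ψ
  simp only [Pi.add_apply, quadFun_eq_inner hL, _root_.add_apply, inner_add_right]

theorem quadFun_smul (c : ℂ) (G : L2Hol μ →L[ℂ] L2Hol μ) : quadFun (c • G) = c • quadFun G := by
  funext Ψ
  simp only [Pi.smul_apply, quadFun_eq_inner hL, _root_.smul_apply, L2Hol.inner_smul_right,
    smul_eq_mul]

theorem hasDerivAt_quadFun (G : L2Hol μ →L[ℂ] L2Hol μ) (Ψ v : HidaTest N) :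
    HasDerivAt (fun t : ℝ => quadFun G (Ψ + (t : ℂ) • v))
      (⟪incl μ Ψ, G (incl μ v)⟫_ℂ + ⟪incl μ v, G (incl μ Ψ)⟫_ℂ) 0 := by
  have hexp : (fun t : ℝ => quadFun G (Ψ + (t : ℂ) • v)) = fun t : ℝ =>
      ⟪incl μ Ψ, G (incl μ Ψ)⟫_ℂ
        + (t : ℂ) * (⟪incl μ Ψ, G (incl μ v)⟫_ℂ + ⟪incl μ v, G (incl μ Ψ)⟫_ℂ)
        + (t : ℂ) ^ 2 * ⟪incl μ v, G (incl μ v)⟫_ℂ := by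
    funext t
    simp only [quadFun_eq_inner hL, incl_add hL, incl_smul hL, map_add, map_smul, inner_add_left,
      inner_add_right, L2Hol.inner_smul_left, L2Hol.inner_smul_right, Complex.conj_ofReal]
    ring
  rw [hexp]
  have ht : HasDerivAt (fun t : ℝ => (t : ℂ)) 1 0 := Complex.ofRealCLM.hasDerivAt
  have h := ((ht.mul_const (⟪incl μ Ψ, G (incl μ v)⟫_ℂ + ⟪incl μ v, G (incl μ Ψ)⟫_ℂ)).const_add
    (⟪incl μ Ψ, G (incl μ Ψ)⟫_ℂ)).add ((ht.pow 2).mul_const (⟪incl μ v, G (incl μ v)⟫_ℂ))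
  exact h.congr_deriv (by norm_num)

theorem gateaux_quadFun (G : L2Hol μ →L[ℂ] L2Hol μ) (Ψ v : HidaTest N) :
    gateaux (quadFun G) Ψ v = ⟪incl μ Ψ, G (incl μ v)⟫_ℂ + ⟪incl μ v, G (incl μ Ψ)⟫_ℂ :=
  (hasDerivAt_quadFun hL G Ψ v).deriv

/-- The derivative is $\langle\Psi,\hat Gv\rangle+\langle v,\hat G\Psi\rangle$; $\partial$ keeps the
part linear in $v$, and the adjoint moves $\hat G$ to the left. -/
theorem represents_wirtinger_quadFun (G : L2Hol μ →L[ℂ] L2Hol μ) (Ψ : HidaTest N) :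
    Represents (wirtinger (quadFun G) Ψ) (ContinuousLinearMap.adjoint G (incl μ Ψ)) := by
  intro v
  simp only [wirtinger, gateaux_quadFun hL, incl_smul hL, map_smul, L2Hol.inner_smul_left,
    L2Hol.inner_smul_right, Complex.conj_I, ContinuousLinearMap.adjoint_inner_left]
  linear_combination (-(⟪incl μ Ψ, G (incl μ v)⟫_ℂ - ⟪incl μ v, G (incl μ Ψ)⟫_ℂ) / 2) * I_mul_I

theorem representsBar_wirtingerBar_quadFun (G : L2Hol μ →L[ℂ] L2Hol μ) (Ψ : HidaTest N) :
    RepresentsBar (wirtingerBar (quadFun G) Ψ) (G (incl μ Ψ)) := by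
  intro v
  simp only [wirtingerBar, gateaux_quadFun hL, incl_smul hL, map_smul, L2Hol.inner_smul_left,
    L2Hol.inner_smul_right, Complex.conj_I]
  linear_combination ((⟪incl μ Ψ, G (incl μ v)⟫_ℂ - ⟪incl μ v, G (incl μ Ψ)⟫_ℂ) / 2) * I_mul_I

theorem isPoissonDifferentiable_quadFun (G : L2Hol μ →L[ℂ] L2Hol μ) :
    IsPoissonDifferentiable μ (quadFun G) := by
  refine fun Ψ => ⟨fun v => (hasDerivAt_quadFun hL G Ψ v).differentiableAt, ?_,
    ⟨_, represents_wirtinger_quadFun hL G Ψ⟩, ⟨_, representsBar_wirtingerBar_quadFun hL G Ψ⟩⟩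
  refine ⟨{ toFun := gateaux (quadFun G) Ψ, map_add' := fun v w => ?_, map_smul' := fun r v => ?_ },
    fun v => rfl⟩
  · simp only [gateaux_quadFun hL, incl_add hL, map_add, inner_add_left, inner_add_right]
    ring
  · have : r • v = (r : ℂ) • v := by ext φ; simp
    simp only [this, gateaux_quadFun hL, incl_smul hL, map_smul, L2Hol.inner_smul_left, L2Hol.inner_smul_right,
      Complex.conj_ofReal, RingHom.id_apply, Complex.real_smul]
    ring

/-- Density of the test functions makes representing vectors unique, so the choice in the definition
of $K$ is harmless. -/
theorem inverseHermitian_eq {α β : HidaTest N → ℂ} {a b : L2Hol μ} (ha : Represents α a)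
    (hb : RepresentsBar β b) : inverseHermitian μ α β = ⟪a, b⟫_ℂ := by
  have h : (∃ a : L2Hol μ, Represents α a) ∧ ∃ b : L2Hol μ, RepresentsBar β b := ⟨⟨a, ha⟩, b, hb⟩
  have h1 : h.1.choose = a :=
    eq_of_inner_incl hL fun v => (h.1.choose_spec v).symm.trans (ha v)
  have h2 : h.2.choose = b := eq_of_inner_incl hL fun v => by
    rw [← L2Hol.inner_conj_symm, ← L2Hol.inner_conj_symm b]
    exact congrArg _ ((h.2.choose_spec v).symm.trans (hb v))
  rw [inverseHermitian, dif_pos h, h1, h2]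

theorem poisson_quadFun (G H : L2Hol μ →L[ℂ] L2Hol μ) :
    poisson μ (quadFun G) (quadFun H) = quadFun ((-I) • (G ∘L H - H ∘L G)) := by
  funext Ψ
  have h1 : ⟪ContinuousLinearMap.adjoint G (incl μ Ψ), H (incl μ Ψ)⟫_ℂ
      = ⟪incl μ Ψ, G (H (incl μ Ψ))⟫_ℂ := ContinuousLinearMap.adjoint_inner_left _ _ _
  have h2 : ⟪ContinuousLinearMap.adjoint H (incl μ Ψ), G (incl μ Ψ)⟫_ℂ
      = ⟪incl μ Ψ, H (G (incl μ Ψ))⟫_ℂ := ContinuousLinearMap.adjoint_inner_left _ _ _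
  have h3 : ⟪incl μ Ψ, (G ∘L H - H ∘L G) (incl μ Ψ)⟫_ℂ
      = ⟪incl μ Ψ, G (H (incl μ Ψ))⟫_ℂ - ⟪incl μ Ψ, H (G (incl μ Ψ))⟫_ℂ :=
    inner_sub_right _ _ _
  rw [poisson, inverseHermitian_eq hL (represents_wirtinger_quadFun hL G Ψ)
      (representsBar_wirtingerBar_quadFun hL H Ψ),
    inverseHermitian_eq hL (represents_wirtinger_quadFun hL H Ψ)
      (representsBar_wirtingerBar_quadFun hL G Ψ), h1, h2, ← h3, quadFun_smul hL, Pi.smul_apply,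
    quadFun_eq_inner hL, smul_eq_mul]

theorem jordanMul_quadFun (A B : L2Hol μ →L[ℂ] L2Hol μ) :
    jordanMul μ (quadFun A) (quadFun B) = quadFun ((2⁻¹ : ℂ) • (A ∘L B + B ∘L A)) := by
  rw [jordanMul, moyalMul_quadFun hL, moyalMul_quadFun hL, quadFun_smul hL, quadFun_add hL]

end Algebra

end Quantization

/-! ### Weyl quantization and the Moyal product -/

section Weyl

variable {N : Type*} [AddCommGroup N] [Module ℝ N] [UniformSpace N]
  [IsUniformAddGroup N] [ContinuousSMul ℝ N]
  {Δ : CovarianceForm N} {μ : Measure (ComplexField N)}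

theorem conjPair_add_smul (χ : ComplexTest N) (φ h : ComplexField N) (z : ℂ) :
    conjPair χ (φ + z • h) = conjPair χ φ + z * conjPair χ h := by
  simp [conjPair]; ring

theorem conjPair_add_left (ρ α : ComplexTest N) (φ : ComplexField N) :
    conjPair (ρ + α) φ = conjPair ρ φ + conjPair α φ := by
  simp [conjPair]; ring

theorem norm_conjPair_le {p : Seminorm ℝ N} {φ : ComplexField N} {r : ℝ}
    (h : ∀ ξ, ‖φ ξ‖ ≤ r * p ξ) (χ : ComplexTest N) : ‖conjPair χ φ‖ ≤ r * (p χ.1 + p χ.2) := by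
  refine (norm_sub_le _ _).trans ?_
  rw [norm_mul, Complex.norm_I, one_mul, mul_add]
  exact add_le_add (h _) (h _)

namespace CovarianceForm

theorem conjPair_lower (Δ : CovarianceForm N) (α ρ : ComplexTest N) :
    conjPair α (Δ.lower ρ) = Δ.sesq α ρ := by
  simp only [conjPair, lower, sesq, ContinuousLinearMap.coe_mk', LinearMap.coe_mk, AddHom.coe_mk]
  push_cast
  linear_combination (-(Δ.toForm α.2 ρ.2 : ℂ)) * I_mul_I

theorem lower_add (Δ : CovarianceForm N) (ρ α : ComplexTest N) :
    Δ.lower (ρ + α) = Δ.lower ρ + Δ.lower α := by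
  ext x
  simp [lower]; ring

theorem sesq_add_add (Δ : CovarianceForm N) (ρ α : ComplexTest N) :
    Δ.sesq (ρ + α) (ρ + α)
      = Δ.sesq ρ ρ + Δ.sesq ρ α + Δ.sesq α ρ + Δ.sesq α α := by
  simp [sesq]; ring

/-- The seminorm `ξ ↦ |Δ χ ξ|`. -/
noncomputable def lowerSeminorm (Δ : CovarianceForm N) (χ : ComplexTest N) : Seminorm ℝ N :=
  (normSeminorm ℝ ℂ).comp (Δ.lower χ).toLinearMap

theorem continuous_lowerSeminorm (Δ : CovarianceForm N) (χ : ComplexTest N) :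
    Continuous (Δ.lowerSeminorm χ) :=
  (Δ.lower χ).continuous.norm

end CovarianceForm

/-- Order two and minimal type absorbs the exponential of a linear function. The translation is
absorbed by enlarging the seminorm so that $\Delta\chi$ has dual norm at most $1$. -/
theorem weylAction_mem_hidaTest (Δ : CovarianceForm N) (χ : ComplexTest N) (Ψ : HidaTest N) :
    weylAction Δ χ Ψ ∈ HidaTest N := by
  refine ⟨fun φ h => ?_, fun p hp ε hε => ?_⟩
  · have h1 : ∀ z : ℂ, φ + z • h + I • Δ.lower χ = φ + I • Δ.lower χ + z • h := fun z => by
      abel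
    simp only [weylAction, conjPair_add_smul, h1]
    exact (by fun_prop : Differentiable ℂ fun z : ℂ =>
      Complex.exp (I * (conjPair χ φ + z * conjPair χ h) - Δ.sesq χ χ / 2)).mul
        (Ψ.2.1 (φ + I • Δ.lower χ) h)
  · obtain ⟨C, hC⟩ := Ψ.2.2 (p + Δ.lowerSeminorm χ) (hp.add (Δ.continuous_lowerSeminorm χ))
      (ε / 4) (by positivity)
    set A := p χ.1 + p χ.2 with hA
    set B := ‖Δ.sesq χ χ / 2‖ with hB
    refine ⟨Real.exp (A ^ 2 / (2 * ε) + B) * (|C| * Real.exp (ε / 2)), fun φ r hr hφ => ?_⟩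
    have h1 : ‖Complex.exp (I * conjPair χ φ - Δ.sesq χ χ / 2)‖
        ≤ Real.exp (A ^ 2 / (2 * ε) + B) * Real.exp (ε / 2 * r ^ 2) := by
      rw [Complex.norm_exp, ← Real.exp_add]
      refine Real.exp_le_exp.2 ((Complex.re_le_norm _).trans ((norm_sub_le _ _).trans ?_))
      rw [norm_mul, Complex.norm_I, one_mul]
      have h2 := norm_conjPair_le hφ χ
      -- Weighted arithmetic-geometric mean inequality: half of $\varepsilon$ pays for the
      -- exponential, the other half for the translated function.
      have h3 : r * A ≤ A ^ 2 / (2 * ε) + ε / 2 * r ^ 2 := by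
        have : A ^ 2 / (2 * ε) + ε / 2 * r ^ 2 - r * A = (A - ε * r) ^ 2 / (2 * ε) := by
          field_simp; ring
        have : 0 ≤ (A - ε * r) ^ 2 / (2 * ε) := by positivity
        linarith
      linarith
    have h2 : ‖(Ψ : ComplexField N → ℂ) (φ + I • Δ.lower χ)‖
        ≤ |C| * Real.exp (ε / 2) * Real.exp (ε / 2 * r ^ 2) := by
      refine (hC _ (r + 1) (by positivity) fun ξ => ?_).trans ?_
      · have hn : ‖(φ + I • Δ.lower χ) ξ‖ ≤ ‖φ ξ‖ + ‖Δ.lower χ ξ‖ := by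
          refine (norm_add_le (φ ξ) (I * Δ.lower χ ξ)).trans_eq ?_
          rw [norm_mul, Complex.norm_I, one_mul]
        have hs : (p + Δ.lowerSeminorm χ) ξ = p ξ + ‖Δ.lower χ ξ‖ := rfl
        rw [hs]
        nlinarith [hφ ξ, apply_nonneg p ξ, norm_nonneg (Δ.lower χ ξ),
          mul_nonneg hr (norm_nonneg (Δ.lower χ ξ))]
      · rw [mul_assoc, ← Real.exp_add]
        refine mul_le_mul (le_abs_self C) (Real.exp_le_exp.2 ?_) (Real.exp_nonneg _)
          (abs_nonneg C)
        -- $(r+1)^2\le2r^2+2$, which is why $\Psi$ was bounded with $\varepsilon/4$.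
        nlinarith [mul_nonneg hε.le (sq_nonneg (r - 1))]
    have h3 : Real.exp (ε * r ^ 2) = Real.exp (ε / 2 * r ^ 2) * Real.exp (ε / 2 * r ^ 2) := by
      rw [← Real.exp_add]; ring_nf
    rw [weylAction, norm_mul, h3]
    exact (mul_le_mul h1 h2 (norm_nonneg _) (by positivity)).trans_eq (by ring)

/-- The Weyl quantization of a trigonometric polynomial, acting on Hida test functions. -/
noncomputable def weylPoly (Δ : CovarianceForm N) (F : TrigPoly N) (Ψ : HidaTest N) : HidaTest N :=
  F.sum fun χ c => c • ⟨weylAction Δ χ Ψ, weylAction_mem_hidaTest Δ χ Ψ⟩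

theorem weylPoly_apply (Δ : CovarianceForm N) (F : TrigPoly N) (Ψ : HidaTest N)
    (σ : ComplexField N) :
    (weylPoly Δ F Ψ : ComplexField N → ℂ) σ = F.sum fun χ c => c * weylAction Δ χ Ψ σ := by
  simp only [weylPoly, Finsupp.sum, Submodule.coe_sum, Finset.sum_apply, Submodule.coe_smul,
    Pi.smul_apply, smul_eq_mul]

/-- The Weyl relations. -/
theorem weylAction_weylAction (Δ : CovarianceForm N) (ρ α : ComplexTest N)
    (Ψ : ComplexField N → ℂ) (σ : ComplexField N) :
    weylAction Δ ρ (weylAction Δ α Ψ) σ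
      = Complex.exp ((Δ.sesq ρ α - Δ.sesq α ρ) / 2) * weylAction Δ (ρ + α) Ψ σ := by
  have h1 : σ + I • Δ.lower ρ + I • Δ.lower α = σ + I • Δ.lower (ρ + α) := by
    rw [Δ.lower_add]
    ext x
    simp; ring
  simp only [weylAction]
  rw [h1, ← mul_assoc, ← mul_assoc, ← Complex.exp_add, ← Complex.exp_add, conjPair_add_smul,
    Δ.conjPair_lower, conjPair_add_left, Δ.sesq_add_add]
  congr 2
  -- The shift by $i\Delta\rho$ contributes $-\bar\alpha\Delta\rho$, which is the cross term
  -- $-(\bar\rho\Delta\alpha+\bar\alpha\Delta\rho)/2$ of $\mathcal E_{\rho+\alpha}$ plus the phase.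
  linear_combination (Δ.sesq α ρ) * I_mul_I

theorem weylPoly_moyalStar (Δ : CovarianceForm N) (F G : TrigPoly N) (Ψ : HidaTest N) :
    weylPoly Δ (moyalStar Δ F G) Ψ = weylPoly Δ F (weylPoly Δ G Ψ) := by
  ext σ
  rw [weylPoly_apply, weylPoly_apply, moyalStar, Finsupp.sum_sum_index (by simp) (by simp [add_mul])]
  refine Finsupp.sum_congr fun ρ _ => ?_
  rw [Finsupp.sum_sum_index (by simp) (by simp [add_mul])]
  have h : weylAction Δ ρ (weylPoly Δ G Ψ) σ
      = G.sum fun α b => b * weylAction Δ ρ (weylAction Δ α Ψ) σ := by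
    simp only [weylAction, weylPoly_apply, Finsupp.sum, Finset.mul_sum]
    exact Finset.sum_congr rfl fun α _ => by ring
  rw [h, Finsupp.sum, Finsupp.sum, Finset.mul_sum]
  refine Finset.sum_congr rfl fun α _ => ?_
  rw [Finsupp.sum_single_index (by simp), weylAction_weylAction]
  ring

/-- Since the quantized polynomial maps $\mathscr P$ to itself, the almost everywhere identity
becomes an equality of vectors that can be iterated. -/
theorem isWeylQuantization_iff (hL : ∀ Ψ : HidaTest N, MemLp (Ψ : ComplexField N → ℂ) 2 μ)
    {F : TrigPoly N} {U : L2Hol μ →L[ℂ] L2Hol μ} :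
    IsWeylQuantization μ Δ F U ↔ ∀ Ψ, U (incl μ Ψ) = incl μ (weylPoly Δ F Ψ) := by
  refine forall_congr' fun Ψ => ?_
  have h : (weylPoly Δ F Ψ : ComplexField N → ℂ)
      = fun σ => F.sum fun χ c => c * weylAction Δ χ Ψ σ := funext (weylPoly_apply Δ F Ψ)
  rw [← h]
  exact ⟨incl_eq_of_ae_eq (hL _), fun h => h ▸ coeFn_incl (hL _)⟩

theorem IsWeylQuantization.comp (hL : ∀ Ψ : HidaTest N, MemLp (Ψ : ComplexField N → ℂ) 2 μ)
    {F G : TrigPoly N} {U V : L2Hol μ →L[ℂ] L2Hol μ} (hU : IsWeylQuantization μ Δ F U)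
    (hV : IsWeylQuantization μ Δ G V) : IsWeylQuantization μ Δ (moyalStar Δ F G) (U ∘L V) := by
  rw [isWeylQuantization_iff hL] at *
  intro Ψ
  rw [ContinuousLinearMap.comp_apply, hV, hU, weylPoly_moyalStar]

theorem tendsto_clm_comp {E : Type*} [NormedAddCommGroup E] [NormedSpace ℂ E] {ι : Type*}
    {l : Filter ι} {U V : ι → E →L[ℂ] E} {G H : E →L[ℂ] E} (hU : Tendsto U l (𝓝 G))
    (hV : Tendsto V l (𝓝 H)) : Tendsto (fun n => U n ∘L V n) l (𝓝 (G ∘L H)) :=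
  hU.mul hV

theorem IsWeylLimit.comp (hL : ∀ Ψ : HidaTest N, MemLp (Ψ : ComplexField N → ℂ) 2 μ)
    {F F' : ℕ → TrigPoly N} {G H : L2Hol μ →L[ℂ] L2Hol μ} (hG : IsWeylLimit μ Δ F G)
    (hH : IsWeylLimit μ Δ F' H) :
    IsWeylLimit μ Δ (fun n => moyalStar Δ (F n) (F' n)) (G ∘L H) := by
  obtain ⟨U, hU, hUG⟩ := hG
  obtain ⟨V, hV, hVH⟩ := hH
  refine ⟨fun n => U n ∘L V n, fun n => (hU n).comp hL (hV n), ?_⟩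
  exact tendsto_clm_comp hUG hVH

end Weyl

theorem mainTheorem5 {N : Type*} [AddCommGroup N] [Module ℝ N] [UniformSpace N]
    [IsUniformAddGroup N] [ContinuousSMul ℝ N] [IsNuclearFrechet N]
    (Δ : CovarianceForm N) (μ : Measure (ComplexField N)) (hμ : IsHolomorphicGaussian Δ μ) :
    -- the manifold of pure states is contained in the Hilbert space
    (∀ Ψ : HidaTest N, MemLp (Ψ : ComplexField N → ℂ) 2 μ) ∧
    -- a quadratic function determines its operator, so that the product is well defined
    (∀ G H : L2Hol μ →L[ℂ] L2Hol μ, quadFun G = quadFun H → G = H) ∧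
    -- the product of quadratic functions is composition of operators, hence the Moyal product
    (∀ G H : L2Hol μ →L[ℂ] L2Hol μ,
      moyalMul μ (quadFun G) (quadFun H) = quadFun (G ∘L H)) ∧
    (∀ (F F' : ℕ → TrigPoly N) (G H : L2Hol μ →L[ℂ] L2Hol μ),
      IsWeylLimit μ Δ F G → IsWeylLimit μ Δ F' H →
        ∃ K : L2Hol μ →L[ℂ] L2Hol μ, IsWeylLimit μ Δ (fun n => moyalStar Δ (F n) (F' n)) K ∧
          moyalMul μ (quadFun G) (quadFun H) = quadFun K) ∧
    -- the Poisson bracket of quadratic functions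
    (∀ G : L2Hol μ →L[ℂ] L2Hol μ, IsPoissonDifferentiable μ (quadFun G)) ∧
    (∀ G H : L2Hol μ →L[ℂ] L2Hol μ,
      poisson μ (quadFun G) (quadFun H)
          = (-I) • (moyalMul μ (quadFun G) (quadFun H) - moyalMul μ (quadFun H) (quadFun G)) ∧
      poisson μ (quadFun G) (quadFun H) = quadFun ((-I) • (G ∘L H - H ∘L G))) ∧
    -- the decomposition of the product by the Jordan product and the Poisson bracket
    (∀ A B : L2Hol μ →L[ℂ] L2Hol μ,
      jordanMul μ (quadFun A) (quadFun B) = quadFun ((2⁻¹ : ℂ) • (A ∘L B + B ∘L A)) ∧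
      moyalMul μ (quadFun A) (quadFun B)
        = jordanMul μ (quadFun A) (quadFun B)
          + (I / 2) • poisson μ (quadFun A) (quadFun B)) := by
  have hL : ∀ Ψ : HidaTest N, MemLp (Ψ : ComplexField N → ℂ) 2 μ := HidaTest.memLp hμ
  refine ⟨hL, fun _ _ => quadFun_injective hL, moyalMul_quadFun hL,
    fun F F' G H hG hH => ⟨G ∘L H, hG.comp hL hH, moyalMul_quadFun hL G H⟩,
    isPoissonDifferentiable_quadFun hL, fun G H => ⟨?_, poisson_quadFun hL G H⟩,
    fun A B => ⟨jordanMul_quadFun hL A B, ?_⟩⟩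
  · have h : quadFun (G ∘L H - H ∘L G) = quadFun (G ∘L H) - quadFun (H ∘L G) :=
      eq_sub_of_add_eq (by rw [← quadFun_add hL, sub_add_cancel])
    rw [poisson_quadFun hL, moyalMul_quadFun hL, moyalMul_quadFun hL, quadFun_smul hL, h]
  · rw [moyalMul_quadFun hL, jordanMul_quadFun hL, poisson_quadFun hL, ← quadFun_smul hL,
      ← quadFun_add hL, smul_smul]
    congr 1
    -- The bracket thus contributes half of the commutator, which complements half of the
    -- anticommutator to $\hat A\hat B$.
    have h : I / 2 * -I = (2⁻¹ : ℂ) := by linear_combination (-1 / 2 : ℂ) * I_mul_I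
    rw [h]
    module
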